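/- Let $X$ be a finite cell complex, given by finite ordered sets $X_0,\dots,X_d$ of cells (with $X_j=\emptyset$ for $j>d$), the free abelian groups $C_j=\mathbb{Z}^{X_j}$ for $j\ge 0$ and $C_{-1}=\mathbb{Z}$, and integer boundary matrices $\partial_j:C_j\to C_{j-1}$ with $\partial_{j}\partial_{j+1}=0$ for all $j\ge 0$, where $\partial_0$ is the augmentation sending every vertex to $1$. Put $\delta_j=\partial_{j+1}^t:C_j\to C_{j+1}$, $Z_j=\ker\partial_j$, $Z^j=\ker\delta_j$, $B^j=\operatorname{im}\delta_{j-1}$, $\widetilde H_j(X)=Z_j/\operatorname{im}\partial_{j+1}$ and $\widetilde H^j(X)=Z^j/B^j$; here $\partial_{-1}=0$ and $B^{-1}=0$. Let $i\ge 0$ be such that the unicycle condition holds: $$\operatorname{rk}\widetilde H_{i+1}(X)=0,\qquad \operatorname{rk}\widetilde H_i(X)=1,\qquad \operatorname{rk}\widetilde H_{i-1}(X)=0 .$$ * An $i$-tree is a subcomplex $T=X^{i-1}\cup I$ with $I\subseteq X_i$ such that the columns of $\partial_i$ indexed by $I$ form a $\mathbb{Q}$-basis of the column space of $\partial_i$.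 The $i$-tree number is $k_i(X)=\sum_T|\widetilde H_{i-1}(T)|^2$, summed over all $i$-trees $T$. * The dual tree number is $k^i(X)=\det\big([\delta_i]_Z[\delta_i]_Z^t\big)$, where $[\delta_i]_Z$ is the matrix of $\delta_i:C_i\to Z^{i+1}$ with respect to a $\mathbb{Z}$-basis $Z$ of $Z^{i+1}$. * Let $n=\operatorname{rk}Z^{i+1}$. An $i$-dimensional dual cycletree is $U^*=X^{i-1}\cup I$ with $I\subseteq X_i$ and $|I|=n+1$. If $A$ is the $n\times(n+1)$ submatrix of $[\delta_i]_Z$ on the columns in $I$, then $C_{U^*}\in Z^i$ is the vector whose entry at the $j$-th element of $I$ is $(-1)^j\det[A]_j$, with $[A]_j$ being $A$ without its $j$-th column, and whose entries outside $I$ are $0$. * The cutting number of $z\in Z^i$ is $c(z)=\det\big([z]_W,[\overline\delta_{i-1}]_W\big)$, where $W$ is a $\mathbb{Z}$-basis of $Z^i$ and the columns of $\overline\delta_{i-1}$ form a $\mathbb{Z}$-basis of the lattice $B^i=\operatorname{im}\delta_{i-1}$ (the determinant is square since $\operatorname{rk}Z^i=\operatorname{rk}B^i+1$). * The standard harmonic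 cocycle is $\lambda^*=\sum_{U^*}c(C_{U^*})\,C_{U^*}\in Z^i$, summed over all $i$-dimensional dual cycletrees $U^*$. Then, for every choice of these bases, $\widetilde H^{i+1}(X)$ is finite and $$\lambda^*\circ\lambda^*=k^i(X)\,k_i(X)\,\big|\widetilde H^{i+1}(X)\big|^2,$$ where $\circ$ is the inner product on $C_i$ for which the cells $X_i$ are orthonormal. -/

import Mathlib

open Matrix

universe u

/-- A finite cell complex, given by its cells and its integer incidence matrices:
`Cell i` is the finite set of `i`-dimensional cells, `incidence i` is the matrix of the boundary map
`∂_{i+1} : C_{i+1} → C_i` (rows indexed by `i`-cells, columns by `(i+1)`-cells), and `∂ ∘ ∂ = 0`,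
including at the augmentation `C_0 → ℤ` sending every vertex to `1`.
The cells of each dimension come in a fixed order, used only to fix signs of determinants. -/
structure CellComplex where
  dim : ℕ
  Cell : ℕ → Type u
  fintypeCell : ∀ i, Fintype (Cell i)
  linearOrderCell : ∀ i, LinearOrder (Cell i)
  isEmpty_cell : ∀ i, dim < i → IsEmpty (Cell i)
  incidence : ∀ i, Matrix (Cell i) (Cell (i + 1)) ℤ
  sum_incidence_zero : ∀ e : Cell 1, ∑ v, incidence 0 v e = 0
  incidence_mul : ∀ i, incidence i * incidence (i + 1) = 0

namespace CellComplex

variable (X : CellComplex.{u})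

/-! ### The augmented chain complex

It is indexed with a shift by one: index `n` stands for dimension `n - 1`, so that index `0` is
the dimension `-1` of the empty cell, and `X.Face (i + 1)` is the set of `i`-cells. -/

/-- The set of `(n-1)`-dimensional cells, the empty cell being the only one of dimension `-1`. -/
def Face : ℕ → Type u
  | 0 => PUnit
  | i + 1 => X.Cell i

instance instFintypeFace : ∀ n, Fintype (X.Face n)
  | 0 => inferInstanceAs (Fintype PUnit)
  | i + 1 => X.fintypeCell i

instance instLinearOrderFace : ∀ n, LinearOrder (X.Face n)
  | 0 => inferInstanceAs (LinearOrder PUnit)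
  | i + 1 => X.linearOrderCell i

/-- The matrix of `∂_n : C_n → C_{n-1}` in the augmented complex; `∂_0` is the all-ones row. -/
def bd : ∀ n, Matrix (X.Face n) (X.Face (n + 1)) ℤ
  | 0 => Matrix.of fun _ _ => 1
  | i + 1 => X.incidence i

theorem bd_mul_bd : ∀ n, X.bd n * X.bd (n + 1) = 0
  | 0 => by
    ext a e
    have h := X.sum_incidence_zero e
    rw [Matrix.mul_apply]
    change ∑ v : X.Face 1, (1 : ℤ) * X.incidence 0 v e = 0
    simp only [one_mul]
    exact h
  | i + 1 => X.incidence_mul i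

/-- `∂_n : C_n → C_{n-1}`. -/
def bdMap (n : ℕ) : (X.Face (n + 1) → ℤ) →ₗ[ℤ] (X.Face n → ℤ) := (X.bd n).mulVecLin

/-- `δ_{n-1} = (∂_n)ᵗ : C_{n-1} → C_n`. -/
def cobdMap (n : ℕ) : (X.Face n → ℤ) →ₗ[ℤ] (X.Face (n + 1) → ℤ) := (X.bd n)ᵀ.mulVecLin

/-- The cycle group `Z_{n-1} = ker ∂_{n-1}`. -/
def cycles : ∀ n, Submodule ℤ (X.Face n → ℤ)
  | 0 => ⊤
  | n + 1 => LinearMap.ker (X.bdMap n)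

/-- The boundary group `B_{n-1} = im ∂_n`. -/
def boundaries (n : ℕ) : Submodule ℤ (X.Face n → ℤ) := LinearMap.range (X.bdMap n)

/-- The reduced homology group `H̃_{n-1}(X) = Z_{n-1} / B_{n-1}`. -/
abbrev redHomology (n : ℕ) : Type u := X.cycles n ⧸ (X.boundaries n).submoduleOf (X.cycles n)

/-- The cocycle group `Z^{n-1} = ker δ_{n-1}`. -/
def cocycles (n : ℕ) : Submodule ℤ (X.Face n → ℤ) := LinearMap.ker (X.cobdMap n)

/-- The coboundary group `B^{n-1} = im δ_{n-2}`. -/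
def coboundaries : ∀ n, Submodule ℤ (X.Face n → ℤ)
  | 0 => ⊥
  | n + 1 => LinearMap.range (X.cobdMap n)

/-- The reduced cohomology group `H̃^{n-1}(X) = Z^{n-1} / B^{n-1}`. -/
abbrev redCohomology (n : ℕ) : Type u :=
  X.cocycles n ⧸ (X.coboundaries n).submoduleOf (X.cocycles n)

theorem cobdMap_mem_cocycles (n : ℕ) (x : X.Face n → ℤ) :
    X.cobdMap n x ∈ X.cocycles (n + 1) := by
  simp only [cocycles, cobdMap, LinearMap.mem_ker, Matrix.mulVecLin_apply, Matrix.mulVec_mulVec,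
    ← Matrix.transpose_mul, bd_mul_bd, Matrix.transpose_zero, Matrix.zero_mulVec]

theorem coboundaries_le_cocycles : ∀ n, X.coboundaries n ≤ X.cocycles n
  | 0 => bot_le
  | n + 1 => by
    rintro _ ⟨x, rfl⟩
    exact X.cobdMap_mem_cocycles n x

/-! ### Unicycle condition -/

/-- The unicycle condition in dimension `i`:
`rk H̃_{i+1}(X) = 0`, `rk H̃_i(X) = 1` and `rk H̃_{i-1}(X) = 0`. -/
structure Unicycle (i : ℕ) : Prop where
  rank_succ : Module.finrank ℤ (X.redHomology (i + 2)) = 0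
  rank_self : Module.finrank ℤ (X.redHomology (i + 1)) = 1
  rank_pred : Module.finrank ℤ (X.redHomology i) = 0

/-! ### Spanning trees

An element `Y = X^{i-1} ∪ I(Y)` of `S_i` is given by its set `I` of `i`-cells. -/

/-- The column of `∂_i` indexed by the `i`-cell `e`, as a rational vector. -/
def bdCol (i : ℕ) (e : X.Face (i + 1)) : X.Face i → ℚ := fun f => (X.bd i f e : ℚ)

/-- `X^{i-1} ∪ I` is an `i`-dimensional spanning tree: the columns of `∂_i` indexed by `I` form a
`ℚ`-basis of the column space of `∂_i`. -/
def IsSpanningTree (i : ℕ) (I : Finset (X.Face (i + 1))) : Prop :=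
  LinearIndepOn ℚ (X.bdCol i) (I : Set (X.Face (i + 1))) ∧
    Submodule.span ℚ (X.bdCol i '' (I : Set (X.Face (i + 1)))) =
      Submodule.span ℚ (Set.range (X.bdCol i))

/-- `B_{i-1}(T)` for the subcomplex `T = X^{i-1} ∪ I`: the image under `∂_i` of the `i`-chains
supported on `I`. -/
def subBoundaries (i : ℕ) (I : Finset (X.Face (i + 1))) : Submodule ℤ (X.Face i → ℤ) :=
  Submodule.map (X.bdMap i)
    (Submodule.span ℤ ((fun e => (Pi.single e 1 : X.Face (i + 1) → ℤ)) '' (I : Set _)))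

/-- `H̃_{i-1}(T)` for the subcomplex `T = X^{i-1} ∪ I`, where `Z_{i-1}(T) = Z_{i-1}(X)` because `T`
and `X` have the same `(i-1)`-skeleton. -/
abbrev subRedHomology (i : ℕ) (I : Finset (X.Face (i + 1))) : Type u :=
  X.cycles i ⧸ (X.subBoundaries i I).submoduleOf (X.cycles i)

/-- The weight `|H̃_{i-1}(T)|` of `T = X^{i-1} ∪ I` (zero when that group is infinite). -/
noncomputable def weight (i : ℕ) (I : Finset (X.Face (i + 1))) : ℕ :=
  Nat.card (X.subRedHomology i I)

open Classical in
/-- The `i`-tree number `k_i(X)`: the sum of the squared weights of all `i`-trees. -/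
noncomputable def treeNumber (i : ℕ) : ℕ :=
  ∑ I : Finset (X.Face (i + 1)) with X.IsSpanningTree i I, X.weight i I ^ 2

/-! ### Dual trees, dual cycletrees and the standard harmonic cocycle -/

/-- `rk Z^{i+1}(X)`. -/
noncomputable abbrev cocycleRank (i : ℕ) : ℕ := Module.finrank ℤ (X.cocycles (i + 2))

/-- `rk B^i(X)`. -/
noncomputable abbrev coboundaryRank (i : ℕ) : ℕ := Module.finrank ℤ (X.coboundaries (i + 1))

variable {X}

/-- The matrix `[δ_i]_Z` of `δ_i : C_i → Z^{i+1}` with respect to a `ℤ`-basis `Z` of `Z^{i+1}(X)`. -/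
noncomputable def cobdMatrix {i : ℕ}
    (Z : Module.Basis (Fin (X.cocycleRank i)) ℤ (X.cocycles (i + 2))) :
    Matrix (Fin (X.cocycleRank i)) (X.Face (i + 1)) ℤ :=
  Matrix.of fun k e =>
    Z.repr ⟨X.cobdMap (i + 1) (Pi.single e 1), X.cobdMap_mem_cocycles (i + 1) _⟩ k

/-- The `i`-th dual tree number `k^i(X) = det ([δ_i]_Z [δ_i]_Zᵗ)`. -/
noncomputable def dualTreeNumber {i : ℕ}
    (Z : Module.Basis (Fin (X.cocycleRank i)) ℤ (X.cocycles (i + 2))) : ℤ :=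
  (cobdMatrix Z * (cobdMatrix Z)ᵀ).det

/-- For an `n × (n+1)` matrix `A`, the vector with entries `(-1)^j det [A]_j`, where `[A]_j` is `A`
without its `j`-th column and columns are counted from `1`. -/
def orthVector {n : ℕ} (A : Matrix (Fin n) (Fin (n + 1)) ℤ) : Fin (n + 1) → ℤ :=
  fun j => (-1) ^ ((j : ℕ) + 1) * (A.submatrix id j.succAbove).det

theorem mulVec_orthVector {n : ℕ} (A : Matrix (Fin n) (Fin (n + 1)) ℤ) :
    A *ᵥ orthVector A = 0 := by
  ext k
  let M : Matrix (Fin (n + 1)) (Fin (n + 1)) ℤ := Matrix.of (Matrix.vecCons (A k) A)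
  have h0 : M.det = 0 := by
    refine Matrix.det_zero_of_row_eq (i := 0) (j := k.succ) (Fin.succ_ne_zero k).symm ?_
    rfl
  rw [Matrix.det_succ_row_zero] at h0
  have hM : ∀ j : Fin (n + 1), M.submatrix Fin.succ j.succAbove = A.submatrix id j.succAbove := by
    intro j
    rfl
  simp only [hM] at h0
  have h1 : (A *ᵥ orthVector A) k
      = -∑ j : Fin (n + 1), (-1) ^ (j : ℕ) * M 0 j * (A.submatrix id j.succAbove).det := by
    rw [Matrix.mulVec, dotProduct, ← Finset.sum_neg_distrib]
    refine Finset.sum_congr rfl fun j _ => ?_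
    have hj : M 0 j = A k j := rfl
    rw [hj]
    simp only [orthVector]
    ring
  rw [h1, h0]
  simp

/-- An `i`-dimensional dual cycletree `U* = X^{i-1} ∪ I`, given by its set `I` of `i`-cells, which
has `rk Z^{i+1}(X) + 1` elements. -/
abbrev DualCycletree (X : CellComplex.{u}) (i : ℕ) : Type u :=
  {I : Finset (X.Face (i + 1)) // I.card = X.cocycleRank i + 1}

/-- The vector `C_{U*}`: the vector `orthVector` of the submatrix of `[δ_i]_Z` on the columns in
`I(U*)`, extended by zero outside `I(U*)`. -/
noncomputable def cocyclePartVec {i : ℕ}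
    (Z : Module.Basis (Fin (X.cocycleRank i)) ℤ (X.cocycles (i + 2)))
    (U : X.DualCycletree i) : X.Face (i + 1) → ℤ :=
  Function.extend (U.1.orderEmbOfFin U.2)
    (orthVector ((cobdMatrix Z).submatrix id (U.1.orderEmbOfFin U.2))) 0

theorem cobdMatrix_mulVec {i : ℕ}
    (Z : Module.Basis (Fin (X.cocycleRank i)) ℤ (X.cocycles (i + 2))) (x : X.Face (i + 1) → ℤ)
    (k : Fin (X.cocycleRank i)) :
    (cobdMatrix Z *ᵥ x) k
      = Z.repr ⟨X.cobdMap (i + 1) x, X.cobdMap_mem_cocycles (i + 1) _⟩ k := by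
  let f : (X.Face (i + 1) → ℤ) →ₗ[ℤ] X.cocycles (i + 2) :=
    (X.cobdMap (i + 1)).codRestrict _ (X.cobdMap_mem_cocycles (i + 1))
  change _ = Z.repr (f x) k
  have hx : x = ∑ e, x e • (Pi.single e 1 : X.Face (i + 1) → ℤ) := by
    ext e
    simp [Finset.sum_apply, Pi.single_apply]
  conv_rhs => rw [hx]
  simp only [map_sum, map_smul, Finsupp.coe_finsetSum, Finset.sum_apply, Finsupp.smul_apply,
    smul_eq_mul]
  rw [Matrix.mulVec, dotProduct]
  refine Finset.sum_congr rfl fun e _ => ?_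
  rw [mul_comm]
  rfl

theorem cocyclePartVec_mem {i : ℕ}
    (Z : Module.Basis (Fin (X.cocycleRank i)) ℤ (X.cocycles (i + 2)))
    (U : X.DualCycletree i) : cocyclePartVec Z U ∈ X.cocycles (i + 1) := by
  have h : cobdMatrix Z *ᵥ cocyclePartVec Z U = 0 := by
    rw [← mulVec_orthVector ((cobdMatrix Z).submatrix id (U.1.orderEmbOfFin U.2))]
    ext k
    simp only [Matrix.mulVec, dotProduct, Matrix.submatrix_apply, id]
    rw [← Finset.sum_subset (Finset.subset_univ
      (Finset.univ.map (U.1.orderEmbOfFin U.2).toEmbedding))]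
    · rw [Finset.sum_map]
      refine Finset.sum_congr rfl fun j _ => ?_
      simp only [cocyclePartVec, RelEmbedding.coe_toEmbedding,
        (U.1.orderEmbOfFin U.2).injective.extend_apply]
    · intro e _ he
      have : ¬ ∃ j, U.1.orderEmbOfFin U.2 j = e := by
        rintro ⟨j, rfl⟩
        exact he (by simp)
      simp [cocyclePartVec, Function.extend_apply' _ _ _ this]
  have h2 : (⟨X.cobdMap (i + 1) (cocyclePartVec Z U), X.cobdMap_mem_cocycles (i + 1) _⟩ :
      X.cocycles (i + 2)) = 0 := by
    apply Z.repr.injective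
    ext k
    rw [← cobdMatrix_mulVec Z, h]
    simp
  exact congrArg Subtype.val h2

/-- The cocycle part `C_{U*}` of the dual cycletree `U*`, as an element of `Z^i(X)`. -/
noncomputable def cocyclePart {i : ℕ}
    (Z : Module.Basis (Fin (X.cocycleRank i)) ℤ (X.cocycles (i + 2)))
    (U : X.DualCycletree i) : X.cocycles (i + 1) :=
  ⟨cocyclePartVec Z U, cocyclePartVec_mem Z U⟩

/-- The cutting number `c(z) = det ([z]_W, [δ̄_{i-1}]_W)`, where `W` is a `ℤ`-basis of `Z^i(X)` and
the columns `D` of `δ̄_{i-1}` are a `ℤ`-basis of `B^i(X) = im δ_{i-1}`. -/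
noncomputable def cuttingNumber {i : ℕ}
    (W : Module.Basis (Fin (X.coboundaryRank i + 1)) ℤ (X.cocycles (i + 1)))
    (D : Module.Basis (Fin (X.coboundaryRank i)) ℤ (X.coboundaries (i + 1)))
    (z : X.cocycles (i + 1)) : ℤ :=
  Matrix.det (Matrix.of fun a b : Fin (X.coboundaryRank i + 1) =>
    W.repr (Fin.cons (α := fun _ => X.cocycles (i + 1)) z
      (fun j => ⟨(D j : X.Face (i + 1) → ℤ), X.coboundaries_le_cocycles (i + 1) (D j).2⟩) b) a)

/-- The standard harmonic cocycle `λ* = ∑_{U*} c(C_{U*}) C_{U*}`, the sum being over all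
`i`-dimensional dual cycletrees `U*`. -/
noncomputable def harmonicCocycle {i : ℕ}
    (Z : Module.Basis (Fin (X.cocycleRank i)) ℤ (X.cocycles (i + 2)))
    (W : Module.Basis (Fin (X.coboundaryRank i + 1)) ℤ (X.cocycles (i + 1)))
    (D : Module.Basis (Fin (X.coboundaryRank i)) ℤ (X.coboundaries (i + 1))) :
    X.cocycles (i + 1) :=
  ∑ U : X.DualCycletree i, cuttingNumber W D (cocyclePart Z U) • cocyclePart Z U

end CellComplex

/-! Write `k^i`, `k_i` for the two tree numbers, `c` for the cutting number and `h = |H̃^{i+1}|`.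
Bordering `[δ_i]_Z` by a cocycle and applying Cauchy–Binet gives `∑ (z · C_U) C_U = k^i z` on `Z^i`.
Applying the linear form `c` yields `z · λ* = k^i c(z)` (`dotProduct_harmonicCocycle`). In
particular `λ*` is orthogonal to `B^i`, where `c` vanishes, and `λ* · λ* = k^i c(λ*)`.

It remains to find `c(λ*)`. Let `G(W)`, `G(D)` be the Gram determinants of bases of `Z^i` and `B^i`.
Pairing `(x, D)` with `(λ*, D)` and computing the determinant in two ways gives `c(λ*) G(W) = k^i
G(D)` (`cuttingForm_harmonicCocycle_mul`). Finally `k^i = h² G(W)` (`dualTreeNumber_eq`) and `k_i =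
G(D)` (`treeNumber_eq`), so `c(λ*) = h² k_i`. -/

namespace Matrix

/-! ### The Cauchy–Binet formula. -/

section CauchyBinet

variable {E R : Type*} [Fintype E] [LinearOrder E] [CommRing R] {r : ℕ}

/-- A sum over the injective functions `Fin r → E` is a sum over `r`-subsets and permutations. -/
theorem sum_injective_eq_sum_subset_perm (F : (Fin r → E) → R)
    (hF : ∀ p, ¬ Function.Injective p → F p = 0) :
    ∑ p, F p = ∑ U : {I : Finset E // I.card = r}, ∑ σ : Equiv.Perm (Fin r),
      F (U.1.orderEmbOfFin U.2 ∘ σ) := by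
  classical
  rw [← Fintype.sum_prod_type']
  rw [← Finset.sum_subset (Finset.subset_univ (Finset.univ.filter Function.Injective))
    (fun p _ hp => hF p (by simpa using hp))]
  symm
  refine Finset.sum_bij (fun q _ => q.1.1.orderEmbOfFin q.1.2 ∘ q.2) ?_ ?_ ?_ ?_
  · intro q _
    simpa using (q.1.1.orderEmbOfFin q.1.2).injective.comp q.2.injective
  · rintro ⟨⟨I, hI⟩, σ⟩ _ ⟨⟨J, hJ⟩, τ⟩ _ h
    have hIJ : I = J := by
      have := congrArg Set.range h
      simp only [EquivLike.range_comp, Finset.range_orderEmbOfFin] at this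
      exact_mod_cast this
    subst hIJ
    have : σ = τ := by
      ext k
      have := congrFun h k
      simp only [Function.comp_apply, EmbeddingLike.apply_eq_iff_eq] at this
      rw [this]
    rw [this]
  · intro p hp
    have hp' : Function.Injective p := by simpa using hp
    have hc : (Finset.univ.image p).card = r := by
      rw [Finset.card_image_of_injective _ hp']; simp
    have hmem : ∀ k, p k ∈ Finset.univ.image p := fun k => by simp
    -- The permutation compares `p` with the increasing enumeration of its image.
    let g : Fin r → Fin r := fun k => ((Finset.univ.image p).orderIsoOfFin hc).symm ⟨p k, hmem k⟩
    have hg : Function.Injective g := fun a b hab => by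
      have := ((Finset.univ.image p).orderIsoOfFin hc).symm.injective hab
      exact hp' (by simpa using this)
    refine ⟨(⟨_, hc⟩, Equiv.ofBijective g (Finite.injective_iff_bijective.mp hg)),
      Finset.mem_univ _, ?_⟩
    ext k
    simp [g, ← Finset.coe_orderIsoOfFin_apply]
  · intro q _
    rfl

/-- Expanding the rows of the product multilinearly gives a sum over all choices of columns.
Repeated columns contribute zero, and the remaining choices are grouped by image, the permutations
rebuilding the minor of `B`. -/
theorem cauchyBinet (B C : Matrix (Fin r) E R) :
    (B * Cᵀ).det = ∑ U : {I : Finset E // I.card = r},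
      (B.submatrix id (U.1.orderEmbOfFin U.2)).det *
        (C.submatrix id (U.1.orderEmbOfFin U.2)).det := by
  have h1 : (B * Cᵀ).det = ∑ p : Fin r → E, (∏ k, B k (p k)) * (C.submatrix id p).det := by
    have : B * Cᵀ = Matrix.of fun k => ∑ e, B k e • Cᵀ e := by
      ext k l
      simp [Matrix.mul_apply, Finset.sum_apply]
    rw [this]
    change (detRowAlternating (R := R) (n := Fin r)).toMultilinearMap
      (fun k => ∑ e, B k e • Cᵀ e) = _
    rw [MultilinearMap.map_sum]
    refine Finset.sum_congr rfl fun p _ => ?_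
    rw [MultilinearMap.map_smul_univ, smul_eq_mul, ← Matrix.det_transpose]
    rfl
  rw [h1, sum_injective_eq_sum_subset_perm]
  · refine Finset.sum_congr rfl fun U _ => ?_
    rw [← Matrix.det_transpose (B.submatrix _ _), Matrix.det_apply', Finset.sum_mul]
    refine Finset.sum_congr rfl fun σ _ => ?_
    have hσ : C.submatrix id (U.1.orderEmbOfFin U.2 ∘ σ) =
        (C.submatrix id (U.1.orderEmbOfFin U.2)).submatrix id σ := rfl
    rw [hσ, Matrix.det_permute']
    simp only [Function.comp_apply, Matrix.transpose_apply, Matrix.submatrix_apply, id]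
    ring
  · intro p hp
    rw [Function.Injective] at hp
    push Not at hp
    obtain ⟨a, b, hab, hne⟩ := hp
    rw [Matrix.det_zero_of_column_eq hne (fun k => by simp [hab]), mul_zero]

end CauchyBinet

/-! ### Bordered matrices and vectors of signed maximal minors. -/

section Border

variable {E : Type*} {n : ℕ}

/-- The matrix `A` with a row `z` put on top. -/
def border (z : E → ℤ) (A : Matrix (Fin n) E ℤ) : Matrix (Fin (n + 1)) E ℤ :=
  of (Fin.cons z A : Fin (n + 1) → E → ℤ)

@[simp]
theorem border_zero (z : E → ℤ) (A : Matrix (Fin n) E ℤ) (e : E) : border z A 0 e = z e := rfl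

@[simp]
theorem border_succ (z : E → ℤ) (A : Matrix (Fin n) E ℤ) (k : Fin n) (e : E) :
    border z A k.succ e = A k e := rfl

/-- Since `A y = 0`, the first column of the product is `z · y` followed by zeros; nothing is
required of `z`. -/
theorem det_border_mul_border_transpose [Fintype E] (A : Matrix (Fin n) E ℤ) (y z : E → ℤ)
    (hy : A *ᵥ y = 0) :
    (border z A * (border y A)ᵀ).det = (A * Aᵀ).det * (z ⬝ᵥ y) := by
  rw [← det_transpose, Matrix.det_succ_row_zero, Fin.sum_univ_succ, Finset.sum_eq_zero]
  · have : (border z A * (border y A)ᵀ)ᵀ.submatrix Fin.succ (Fin.succAbove 0) = A * Aᵀ := by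
      ext a b
      simp [Matrix.mul_apply]
    rw [this]
    simp [Matrix.mul_apply, dotProduct, mul_comm]
  · intro j _
    have : (A *ᵥ y) j = 0 := by rw [hy]; rfl
    have h2 : (border z A * (border y A)ᵀ)ᵀ 0 j.succ = 0 := by
      rw [← this]
      simp [Matrix.mul_apply, mulVec, dotProduct]
    rw [h2]
    simp

end Border

section Bordered

variable {E : Type*} [Fintype E] [LinearOrder E] {n : ℕ}

/-- `orthVector` of the columns of `A` in `U`, extended by zero. -/
noncomputable def extOrthVector (A : Matrix (Fin n) E ℤ)
    (U : {I : Finset E // I.card = n + 1}) : E → ℤ :=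
  Function.extend (U.1.orderEmbOfFin U.2)
    (CellComplex.orthVector (A.submatrix id (U.1.orderEmbOfFin U.2))) 0

/-- Laplace expansion along the bordering row. The minus sign comes from `orthVector` counting
columns from 1; it cancels when two such minors are multiplied. -/
theorem det_border_submatrix (A : Matrix (Fin n) E ℤ) (U : {I : Finset E // I.card = n + 1})
    (z : E → ℤ) :
    ((border z A).submatrix id (U.1.orderEmbOfFin U.2)).det
      = -(z ⬝ᵥ extOrthVector A U) := by
  rw [Matrix.det_succ_row_zero, dotProduct, ← Finset.sum_neg_distrib,
    ← Finset.sum_subset (Finset.subset_univ (Finset.univ.map (U.1.orderEmbOfFin U.2).toEmbedding))]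
  · rw [Finset.sum_map]
    refine Finset.sum_congr rfl fun j _ => ?_
    simp only [extOrthVector, RelEmbedding.coe_toEmbedding,
      (U.1.orderEmbOfFin U.2).injective.extend_apply, CellComplex.orthVector]
    have : ((border z A).submatrix id
        (U.1.orderEmbOfFin U.2)).submatrix Fin.succ j.succAbove =
        (A.submatrix id (U.1.orderEmbOfFin U.2)).submatrix id j.succAbove := rfl
    rw [this]
    simp only [submatrix_apply, id, border_zero]
    ring
  · intro e _ he
    have : ¬ ∃ j, U.1.orderEmbOfFin U.2 j = e := by
      rintro ⟨j, rfl⟩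
      exact he (by simp)
    simp [extOrthVector, Function.extend_apply' _ _ _ this]

theorem sum_dotProduct_extOrthVector_mul (A : Matrix (Fin n) E ℤ) (y z : E → ℤ)
    (hy : A *ᵥ y = 0) :
    ∑ U : {I : Finset E // I.card = n + 1}, (z ⬝ᵥ extOrthVector A U) * (y ⬝ᵥ extOrthVector A U)
      = (A * Aᵀ).det * (z ⬝ᵥ y) := by
  have h := cauchyBinet (border z A) (border y A)
  simp only [det_border_submatrix, neg_mul_neg] at h
  rw [← h, det_border_mul_border_transpose A y z hy]

end Bordered

/-! ### Gram determinants of lattices. -/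

section Gram

variable {E ι κ : Type*} [Fintype E] [Fintype ι] [DecidableEq ι] [Fintype κ] [DecidableEq κ]

/-- A vector `v` in the kernel of the Gram matrix makes the combination of the `w k` with
coefficients `v` have zero norm, hence vanish. -/
theorem det_mul_transpose_ne_zero {w : κ → E → ℤ} (hw : LinearIndependent ℤ w) :
    (of w * (of w)ᵀ).det ≠ 0 := by
  intro h
  obtain ⟨v, hv, h0⟩ := exists_vecMul_eq_zero_iff.mpr h
  apply hv
  have h1 : (v ᵥ* of w) ⬝ᵥ (v ᵥ* of w) = 0 := by
    rw [← vecMul_vecMul] at h0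
    have := congrArg (· ⬝ᵥ v) h0
    simp only [zero_dotProduct] at this
    rw [← this, vecMul_transpose, dotProduct_comm _ v, dotProduct_mulVec]
  rw [dotProduct_self_eq_zero] at h1
  ext k
  refine Fintype.linearIndependent_iff.mp hw v ?_ k
  rw [← h1]
  ext e
  simp [vecMul, dotProduct, Finset.sum_apply]

/-- Gram determinants in a lattice with a basis. -/
theorem det_gram_eq {P : Submodule ℤ (E → ℤ)} (W : Module.Basis ι ℤ P) (v w : ι → P) :
    (of (fun k => (v k : E → ℤ)) * (of (fun k => (w k : E → ℤ)))ᵀ).det =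
      (W.toMatrix v).det * (W.toMatrix w).det *
        (of (fun k => (W k : E → ℤ)) * (of (fun k => (W k : E → ℤ)))ᵀ).det := by
  have key : ∀ v : ι → P, of (fun k => (v k : E → ℤ)) =
      (W.toMatrix v)ᵀ * of (fun k => (W k : E → ℤ)) := by
    intro v
    ext k e
    have := congrArg (fun x : P => (x : E → ℤ) e) (W.sum_repr (v k))
    simp only [of_apply, mul_apply, transpose_apply, Module.Basis.toMatrix_apply]
    refine this.symm.trans ?_
    simp [-Module.Basis.sum_repr, Finset.sum_apply]
  rw [key v, key w, transpose_mul, transpose_transpose]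
  have : (W.toMatrix v)ᵀ * of (fun k => (W k : E → ℤ)) *
      ((of (fun k => (W k : E → ℤ)))ᵀ * W.toMatrix w) = (W.toMatrix v)ᵀ *
      (of (fun k => (W k : E → ℤ)) * (of (fun k => (W k : E → ℤ)))ᵀ) * W.toMatrix w := by
    simp only [Matrix.mul_assoc]
  rw [this, det_mul, det_mul, det_transpose]
  ring

/-- Lifts `V` of a basis of the range, together with a basis `K` of the kernel, form a unimodular
matrix `T`. Put `S = (A; K)`. As `A Kᵀ = 0`, `S Sᵀ` is block diagonal and `S Tᵀ` block triangular,
so `det(A Aᵀ) det(K Kᵀ) = det(S)² = det(A Vᵀ)² det(K Kᵀ)²`, and `|det(A Vᵀ)|` is the index of the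
range. Indexing `b` and `Z` by the same `ι` forces this index to be finite. -/
theorem det_mul_transpose_eq_card_sq_mul [DecidableEq E] {N : Type*} [AddCommGroup N]
    (f : (E → ℤ) →ₗ[ℤ] N) (Z : Module.Basis ι ℤ N) (b : Module.Basis ι ℤ (LinearMap.range f))
    {w : κ → E → ℤ} (hw : LinearIndependent ℤ w)
    (hs : Submodule.span ℤ (Set.range w) = LinearMap.ker f)
    (A : Matrix ι E ℤ) (hA : ∀ x, A *ᵥ x = Z.repr (f x)) :
    (A * Aᵀ).det =
      (Nat.card (N ⧸ LinearMap.range f) : ℤ) ^ 2 * (of w * (of w)ᵀ).det := by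
  have := Module.Free.of_basis Z
  have := Module.Finite.of_basis Z
  choose v hv using fun j => LinearMap.mem_range.mp (b j).2
  have hfw : ∀ k, f (w k) = 0 := fun k => by
    rw [← LinearMap.mem_ker, ← hs]
    exact Submodule.subset_span ⟨k, rfl⟩
  have hli : LinearIndependent ℤ (Sum.elim v w) := by
    rw [Fintype.linearIndependent_iff]
    intro g hg
    simp only [Fintype.sum_sum_type, Sum.elim_inl, Sum.elim_inr] at hg
    have h1 : ∀ j, g (Sum.inl j) = 0 := by
      refine Fintype.linearIndependent_iff.mp b.linearIndependent _ ?_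
      apply Subtype.ext
      have := congrArg f hg
      simpa [-zsmul_eq_mul, map_sum, map_zsmul, hfw, hv] using this
    have h2 : ∀ j, g (Sum.inr j) = 0 := by
      refine Fintype.linearIndependent_iff.mp hw _ ?_
      simpa [h1] using hg
    rintro (j | j)
    exacts [h1 j, h2 j]
  have hsp : ⊤ ≤ Submodule.span ℤ (Set.range (Sum.elim v w)) := by
    intro x _
    let y : E → ℤ := ∑ j, b.repr ⟨f x, x, rfl⟩ j • v j
    have hy : f y = f x := by
      have := congrArg Subtype.val (b.sum_repr ⟨f x, x, rfl⟩)
      simp only [Submodule.coe_sum, Submodule.coe_smul, ← hv] at this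
      simpa only [y, map_sum, map_smul] using this
    have hxy : x - y ∈ Submodule.span ℤ (Set.range w) := by
      rw [hs, LinearMap.mem_ker, map_sub, hy, sub_self]
    rw [Set.Sum.elim_range, Submodule.span_union]
    rw [← add_sub_cancel y x]
    refine Submodule.add_mem_sup (Submodule.sum_mem _ fun j _ => ?_) hxy
    exact Submodule.smul_mem _ _ (Submodule.subset_span ⟨j, rfl⟩)
  let B := Module.Basis.mk hli hsp
  -- Identifying the index sets makes `S` and `T` square, so that their determinants exist.
  let e : ι ⊕ κ ≃ E := B.indexEquiv (Pi.basisFun ℤ E)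
  let V : Matrix ι E ℤ := of v
  let K : Matrix κ E ℤ := of w
  let S : Matrix (ι ⊕ κ) E ℤ := fromRows A K
  let T : Matrix (ι ⊕ κ) E ℤ := fromRows V K
  have hAK : A * Kᵀ = 0 := by
    ext i k
    have : (A *ᵥ w k) i = 0 := by rw [hA, hfw]; simp
    simpa [Matrix.mul_apply, mulVec, dotProduct, K] using this
  have hKA : K * Aᵀ = 0 := by
    rw [← transpose_transpose K, ← transpose_mul, hAK, transpose_zero]
  have hT : IsUnit (T.submatrix id e).det := by
    have h := (Pi.basisFun ℤ E).isUnit_det (B.reindex e)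
    rw [Module.Basis.det_apply] at h
    suffices h2 : (T.submatrix id e).det = ((Pi.basisFun ℤ E).toMatrix (B.reindex e)).det by
      rwa [h2]
    rw [← det_transpose, ← det_submatrix_equiv_self e.symm]
    congr 1
    ext x y
    obtain ⟨y | y, rfl⟩ := e.surjective y <;>
      simp [Module.Basis.toMatrix_apply, B, T, V, K]
  have mulsub : ∀ P Q : Matrix (ι ⊕ κ) E ℤ, (P * Qᵀ).det =
      (P.submatrix id e).det * (Q.submatrix id e).det := by
    intro P Q
    rw [← det_transpose (Q.submatrix id e), ← det_mul, transpose_submatrix, submatrix_mul_equiv]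
    rfl
  have hSS : (S * Sᵀ).det = (A * Aᵀ).det * (K * Kᵀ).det := by
    rw [transpose_fromRows, fromRows_mul_fromCols, hAK, hKA, det_fromBlocks_zero₂₁]
  have hST : (S * Tᵀ).det = (A * Vᵀ).det * (K * Kᵀ).det := by
    rw [transpose_fromRows, fromRows_mul_fromCols, hAK, det_fromBlocks_zero₁₂]
  have hAV : ((A * Vᵀ).det).natAbs = Nat.card (N ⧸ LinearMap.range f) := by
    rw [← Submodule.natAbs_det_basis_change Z _ b, Module.Basis.det_apply]
    congr 2
    ext i j
    have : (A *ᵥ v j) i = Z.repr (b j : N) i := by rw [hA, hv]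
    simpa [Matrix.mul_apply, mulVec, dotProduct, V, Module.Basis.toMatrix_apply] using this
  have hG : (K * Kᵀ).det ≠ 0 := det_mul_transpose_ne_zero hw
  rw [← hAV, Int.natCast_natAbs, sq_abs]
  rw [mulsub] at hSS hST
  have hT2 : (T.submatrix id e).det ^ 2 = 1 := by
    rcases Int.isUnit_iff.mp hT with h | h <;> rw [h] <;> norm_num
  apply mul_right_cancel₀ hG
  calc (A * Aᵀ).det * (K * Kᵀ).det
      = ((S.submatrix id e).det * (T.submatrix id e).det) ^ 2 := by
        rw [← hSS, mul_pow, hT2]; ring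
    _ = _ := by rw [hST]; ring

end Gram

/-! ### Maximal minors as lattice indices and as tests for bases. -/

section TreeLemmas

variable {m : ℕ}

theorem card_quotient_span_col {ι : Type*} [Fintype ι] [DecidableEq ι] (M : Matrix ι ι ℤ)
    (hM : M.det ≠ 0) :
    Nat.card ((ι → ℤ) ⧸ Submodule.span ℤ (Set.range M.col)) = M.det.natAbs := by
  have hli : LinearIndependent ℤ M.col := by
    rw [← Matrix.mulVec_injective_iff]
    exact mulVec_injective_of_det_mem_nonZeroDivisors (mem_nonZeroDivisors_of_ne_zero hM)
  rw [← Submodule.natAbs_det_basis_change (Pi.basisFun ℤ ι) _ (Module.Basis.span hli),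
    Module.Basis.det_apply]
  congr 2
  ext i j
  simp [Module.Basis.toMatrix_apply, Module.Basis.span_apply]

theorem linearIndepOn_col_and_span_eq_top_iff {E : Type*} [LinearOrder E]
    (D : Matrix (Fin m) E ℚ) (I : Finset E) :
    (LinearIndepOn ℚ D.col (I : Set E) ∧ Submodule.span ℚ (D.col '' (I : Set E)) = ⊤) ↔
      ∃ h : I.card = m, (D.submatrix id (I.orderEmbOfFin h)).det ≠ 0 := by
  have himg : ∀ h : I.card = m, D.col '' (I : Set E) =
      Set.range (D.submatrix id (I.orderEmbOfFin h)).col := by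
    intro h
    rw [← Finset.range_orderEmbOfFin I h, ← Set.range_comp]
    rfl
  have hlin : ∀ h : I.card = m, LinearIndepOn ℚ D.col (I : Set E) ↔
      LinearIndependent ℚ (D.submatrix id (I.orderEmbOfFin h)).col := by
    intro h
    rw [← Finset.range_orderEmbOfFin I h, linearIndepOn_range_iff (I.orderEmbOfFin h).injective]
    rfl
  constructor
  · rintro ⟨h1, h2⟩
    have hc : I.card = m := by
      have hb := Module.finrank_eq_card_basis (Module.Basis.mk (v := fun e : I => D.col e) h1
        (by rw [← h2, Set.image_eq_range]; rfl))
      simpa using hb.symm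
    refine ⟨hc, ?_⟩
    rw [hlin hc, linearIndependent_cols_iff_isUnit, isUnit_iff_isUnit_det] at h1
    exact h1.ne_zero
  · rintro ⟨hc, h⟩
    have h1 : LinearIndependent ℚ (D.submatrix id (I.orderEmbOfFin hc)).col := by
      rw [linearIndependent_cols_iff_isUnit, isUnit_iff_isUnit_det]
      exact h.isUnit
    refine ⟨(hlin hc).mpr h1, ?_⟩
    rw [himg hc]
    exact h1.span_eq_top_of_card_eq_finrank' (by simp)

end TreeLemmas

end Matrix

/-! ### Ranks and quotients over `ℤ`. -/

theorem LinearMap.finrank_range_add_finrank_ker_int {M N : Type*} [AddCommGroup M]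
    [Module.Finite ℤ M] [AddCommGroup N] (f : M →ₗ[ℤ] N) :
    Module.finrank ℤ (LinearMap.range f) + Module.finrank ℤ (LinearMap.ker f) =
      Module.finrank ℤ M := by
  rw [← f.quotKerEquivRange.finrank_eq, Submodule.finrank_quotient_add_finrank]

namespace Matrix

/-- `MᵀM` and `M` have the same kernel because a sum of squares vanishes only trivially; hence `M`
has the rank of `MᵀM`, which is at most that of `Mᵀ`. -/
theorem rank_le_rank_transpose_int {m n : Type*} [Fintype m] [Fintype n]
    (M : Matrix m n ℤ) : M.rank ≤ Mᵀ.rank := by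
  have hker : LinearMap.ker (Mᵀ * M).mulVecLin = LinearMap.ker M.mulVecLin := by
    ext x
    simp only [LinearMap.mem_ker, mulVecLin_apply, ← mulVec_mulVec]
    refine ⟨fun h => ?_, fun h => by rw [h, mulVec_zero]⟩
    have h := congr_arg (dotProduct x) h
    rwa [dotProduct_mulVec, dotProduct_zero, vecMul_transpose, dotProduct_self_eq_zero] at h
  have h1 := LinearMap.finrank_range_add_finrank_ker_int (Mᵀ * M).mulVecLin
  have h2 := LinearMap.finrank_range_add_finrank_ker_int M.mulVecLin
  rw [hker] at h1
  have h3 : (Mᵀ * M).rank ≤ Mᵀ.rank := rank_mul_le_left _ _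
  simp only [rank] at h3 ⊢
  omega

theorem finrank_range_mulVecLin_transpose {m n : Type*} [Fintype m] [Fintype n]
    (M : Matrix m n ℤ) :
    Module.finrank ℤ (LinearMap.range Mᵀ.mulVecLin) =
      Module.finrank ℤ (LinearMap.range M.mulVecLin) :=
  le_antisymm (rank_le_rank_transpose_int Mᵀ) (rank_le_rank_transpose_int M)

end Matrix

theorem Submodule.finrank_quotient_submoduleOf {M : Type*} [AddCommGroup M] [Module.Finite ℤ M]
    {N P : Submodule ℤ M} (h : N ≤ P) :
    Module.finrank ℤ (P ⧸ N.submoduleOf P) + Module.finrank ℤ N = Module.finrank ℤ P := by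
  rw [← (Submodule.submoduleOfEquivOfLe h).finrank_eq]
  exact Submodule.finrank_quotient_add_finrank _

theorem Submodule.card_quotient_submoduleOf_map {M M' : Type*} [AddCommGroup M] [AddCommGroup M']
    (g : M →ₗ[ℤ] M') (hg : Function.Injective g) {P : Submodule ℤ M'}
    (hP : LinearMap.range g = P) (N : Submodule ℤ M) :
    Nat.card (P ⧸ (N.map g).submoduleOf P) = Nat.card (M ⧸ N) := by
  subst hP
  symm
  refine Nat.card_congr (Submodule.Quotient.equiv _ _ (LinearEquiv.ofInjective g hg) ?_).toEquiv
  ext ⟨_, x, rfl⟩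
  simp only [Submodule.mem_map, Submodule.mem_comap, Submodule.submoduleOf, Submodule.subtype_apply]
  constructor
  · rintro ⟨y, hy, h⟩
    exact ⟨y, hy, congrArg Subtype.val h⟩
  · rintro ⟨y, hy, h⟩
    exact ⟨y, hy, Subtype.ext h⟩

/-! ### Finiteness of cohomology and the dual tree number. -/

namespace CellComplex

variable {X : CellComplex.{u}}

theorem boundaries_le_cycles : ∀ n, X.boundaries n ≤ X.cycles n
  | 0 => le_top
  | n + 1 => by
    rintro _ ⟨x, rfl⟩
    simp only [cycles, bdMap, LinearMap.mem_ker, mulVecLin_apply, mulVec_mulVec, bd_mul_bd,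
      zero_mulVec]

/-- Rank–nullity for `∂` and `δ` on the same chain group, combined with the equality of ranks of a
matrix and its transpose. -/
theorem finrank_coboundaries_eq_finrank_cocycles {n : ℕ}
    (h : Module.finrank ℤ (X.redHomology (n + 1)) = 0) :
    Module.finrank ℤ (X.coboundaries (n + 1)) = Module.finrank ℤ (X.cocycles (n + 1)) := by
  have h1 : Module.finrank ℤ (X.redHomology (n + 1)) + Module.finrank ℤ (X.boundaries (n + 1)) =
      Module.finrank ℤ (X.cycles (n + 1)) :=
    Submodule.finrank_quotient_submoduleOf (X.boundaries_le_cycles (n + 1))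
  have h2 : Module.finrank ℤ (X.boundaries n) + Module.finrank ℤ (X.cycles (n + 1)) =
      Fintype.card (X.Face (n + 1)) :=
    (LinearMap.finrank_range_add_finrank_ker_int (X.bdMap n)).trans
      (Module.finrank_fintype_fun_eq_card ℤ)
  have h3 : Module.finrank ℤ (X.coboundaries (n + 2)) + Module.finrank ℤ (X.cocycles (n + 1)) =
      Fintype.card (X.Face (n + 1)) :=
    (LinearMap.finrank_range_add_finrank_ker_int (X.cobdMap (n + 1))).trans
      (Module.finrank_fintype_fun_eq_card ℤ)
  have h4 : Module.finrank ℤ (X.coboundaries (n + 1)) = Module.finrank ℤ (X.boundaries n) :=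
    finrank_range_mulVecLin_transpose (X.bd n)
  have h5 : Module.finrank ℤ (X.coboundaries (n + 2)) = Module.finrank ℤ (X.boundaries (n + 1)) :=
    finrank_range_mulVecLin_transpose (X.bd (n + 1))
  rw [h, zero_add] at h1
  omega

theorem finite_redCohomology {n : ℕ}
    (h : Module.finrank ℤ (X.redHomology (n + 1)) = 0) : Finite (X.redCohomology (n + 1)) := by
  have h1 := Submodule.finrank_quotient_submoduleOf (X.coboundaries_le_cocycles (n + 1))
  rw [finrank_coboundaries_eq_finrank_cocycles h, Nat.add_eq_right, Module.finrank_eq_zero_iff] at h1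
  refine Module.finite_of_fg_torsion _ fun {x} => ?_
  obtain ⟨a, ha, hx⟩ := h1 x
  exact ⟨⟨a, mem_nonZeroDivisors_of_ne_zero ha⟩, hx⟩

/-- The lattice lemma applied to `δ_i` with codomain `Z^{i+1}`: its kernel is `Z^i` and its cokernel
`H̃^{i+1}`. The rank hypothesis supplies a basis of the range of the required size. -/
theorem dualTreeNumber_eq {i : ℕ} (hX : Module.finrank ℤ (X.redHomology (i + 2)) = 0)
    (Z : Module.Basis (Fin (X.cocycleRank i)) ℤ (X.cocycles (i + 2)))
    {κ : Type*} [Fintype κ] [DecidableEq κ] (W : Module.Basis κ ℤ (X.cocycles (i + 1))) :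
    dualTreeNumber Z = (Nat.card (X.redCohomology (i + 2)) : ℤ) ^ 2 *
      (of (fun k => (W k : X.Face (i + 1) → ℤ)) *
        (of (fun k => (W k : X.Face (i + 1) → ℤ)))ᵀ).det := by
  let f : (X.Face (i + 1) → ℤ) →ₗ[ℤ] X.cocycles (i + 2) :=
    (X.cobdMap (i + 1)).codRestrict _ (X.cobdMap_mem_cocycles (i + 1))
  have hrange : LinearMap.range f = (X.coboundaries (i + 2)).submoduleOf (X.cocycles (i + 2)) := by
    rw [LinearMap.range_codRestrict]
    rfl
  have hker : LinearMap.ker f = X.cocycles (i + 1) := LinearMap.ker_codRestrict _ _ _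
  have hfin : Module.finrank ℤ (LinearMap.range f) = X.cocycleRank i := by
    rw [hrange, (Submodule.submoduleOfEquivOfLe (X.coboundaries_le_cocycles (i + 2))).finrank_eq,
      finrank_coboundaries_eq_finrank_cocycles hX]
  have h := det_mul_transpose_eq_card_sq_mul f Z
    (Module.finBasisOfFinrankEq ℤ (LinearMap.range f) hfin)
    (w := fun k => (W k : X.Face (i + 1) → ℤ))
    (W.linearIndependent.map' (Submodule.subtype _) (Submodule.ker_subtype _))
    (by
      rw [hker]
      have := congrArg (Submodule.map (Submodule.subtype _)) W.span_eq
      rw [Submodule.map_span, Submodule.map_subtype_top, ← Set.range_comp] at this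
      exact this)
    (cobdMatrix Z) (fun x => funext fun k => cobdMatrix_mulVec Z x k)
  rw [hrange] at h
  exact h

/-! ### The tree number as a Gram determinant -/

section TreeNumber

variable {i : ℕ} (D : Module.Basis (Fin (X.coboundaryRank i)) ℤ (X.coboundaries (i + 1)))

/-- The matrix whose rows are the vectors of a basis of `B^i`. -/
noncomputable def coboundaryBasisMatrix : Matrix (Fin (X.coboundaryRank i)) (X.Face (i + 1)) ℤ :=
  of fun j => (D j : X.Face (i + 1) → ℤ)

/-- The coordinates of the coboundaries of the cells with respect to a basis of `B^i`. -/
noncomputable def coboundaryCoordMatrix : Matrix (X.Face i) (Fin (X.coboundaryRank i)) ℤ :=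
  of fun f j => D.repr ⟨X.cobdMap i (Pi.single f 1), _, rfl⟩ j

theorem linearIndependent_coboundaryBasisMatrix :
    LinearIndependent ℤ (fun j => (D j : X.Face (i + 1) → ℤ)) :=
  D.linearIndependent.map' (Submodule.subtype _) (Submodule.ker_subtype _)

/-- This factorization replaces the columns of `∂_i` by those of a matrix of full row rank. -/
theorem coboundaryCoordMatrix_mul :
    coboundaryCoordMatrix D * coboundaryBasisMatrix D = X.bd i := by
  ext f e
  have := congrArg (fun x : X.coboundaries (i + 1) => (x : X.Face (i + 1) → ℤ) e)
    (D.sum_repr ⟨X.cobdMap i (Pi.single f 1), _, rfl⟩)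
  simp only [Submodule.coe_sum, Submodule.coe_smul, Finset.sum_apply, Pi.smul_apply,
    smul_eq_mul] at this
  simp only [mul_apply, coboundaryCoordMatrix, coboundaryBasisMatrix, of_apply]
  rw [this]
  simp [cobdMap]

/-- The rows of `R` are preimages of the basis vectors of `B^i` under `δ_{i-1}`. -/
theorem exists_mul_coboundaryCoordMatrix_eq_one :
    ∃ R : Matrix (Fin (X.coboundaryRank i)) (X.Face i) ℤ, R * coboundaryCoordMatrix D = 1 := by
  choose y hy using fun j => LinearMap.mem_range.mp (D j).2
  refine ⟨of y, ?_⟩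
  ext j k
  let g : (X.Face i → ℤ) →ₗ[ℤ] X.coboundaries (i + 1) := (X.cobdMap i).rangeRestrict
  have hg : g (y j) = D j := Subtype.ext (hy j)
  have h1 : y j = ∑ f, y j f • (Pi.single f 1 : X.Face i → ℤ) := by
    ext e
    simp [Finset.sum_apply, Pi.single_apply]
  have h2 : D.repr (g (y j)) k = ∑ f, y j f * D.repr (g (Pi.single f 1)) k := by
    conv_lhs => rw [h1]
    simp only [map_sum, map_smul, Finsupp.coe_finsetSum, Finset.sum_apply, Finsupp.smul_apply,
      smul_eq_mul]
  rw [hg, D.repr_self, Finsupp.single_apply] at h2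
  rw [Matrix.one_apply, h2]
  rfl

theorem range_coboundaryCoordMatrix (hX : Module.finrank ℤ (X.redHomology i) = 0) :
    LinearMap.range (coboundaryCoordMatrix D).mulVecLin = X.cycles i := by
  obtain ⟨R, hR⟩ := exists_mul_coboundaryCoordMatrix_eq_one D
  have hQD := coboundaryCoordMatrix_mul D
  have hdet := det_mul_transpose_ne_zero (linearIndependent_coboundaryBasisMatrix D)
  set Q := coboundaryCoordMatrix D
  set A := coboundaryBasisMatrix D
  apply le_antisymm
  · cases i with
    | zero => exact le_top
    | succ n =>
      have h0 : X.bd n * Q = 0 := by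
        -- `A Aᵀ` is nonsingular, so its adjugate cancels it up to a nonzero scalar.
        have h1 : X.bd n * Q * (A * Aᵀ) = 0 := by
          rw [← Matrix.mul_assoc, Matrix.mul_assoc _ Q A, hQD, bd_mul_bd, Matrix.zero_mul]
        have h2 := congrArg (· * (A * Aᵀ).adjugate) h1
        simp only [Matrix.mul_assoc, Matrix.zero_mul] at h2
        rw [← Matrix.mul_assoc A, mul_adjugate, Matrix.mul_smul, Matrix.mul_smul, Matrix.mul_one]
          at h2
        exact (smul_eq_zero.mp h2).resolve_left hdet
      rintro _ ⟨x, rfl⟩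
      simp only [cycles, bdMap, LinearMap.mem_ker, mulVecLin_apply, mulVec_mulVec, h0, zero_mulVec]
  · intro z hz
    rw [Module.finrank_eq_zero_iff] at hX
    obtain ⟨a, ha, h⟩ := hX (Submodule.Quotient.mk ⟨z, hz⟩)
    rw [← Submodule.Quotient.mk_smul, Submodule.Quotient.mk_eq_zero] at h
    obtain ⟨x, hx⟩ : a • z ∈ X.boundaries i := h
    -- `QR` is the identity on the image of `Q`, which contains `a z`; dividing by `a` gives `Q R z
    -- = z`.
    refine ⟨R *ᵥ z, ?_⟩
    have h1 : X.bd i *ᵥ x = a • z := hx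
    rw [← hQD, ← mulVec_mulVec] at h1
    have h2 := congrArg (fun v => Q *ᵥ (R *ᵥ v)) h1
    simp only [mulVec_mulVec, ← Matrix.mul_assoc] at h2
    rw [Matrix.mul_assoc Q R Q, hR, Matrix.mul_one, ← mulVec_mulVec, h1, mulVec_smul] at h2
    rw [mulVecLin_apply, mulVec_mulVec]
    exact (smul_right_injective _ ha h2).symm

theorem mulVec_coboundaryCoordMatrix_injective :
    Function.Injective (coboundaryCoordMatrix D).mulVecLin := by
  obtain ⟨R, hR⟩ := exists_mul_coboundaryCoordMatrix_eq_one D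
  intro x y h
  have := congrArg (R *ᵥ ·) h
  simpa [mulVec_mulVec, hR] using this

/-- The coordinate matrix maps the lattice isomorphically onto `Z_{i-1}` and takes the columns of
the basis matrix to those of `∂_i`, so the weight is the index of a lattice spanned by columns. -/
theorem weight_eq_natAbs_det (hX : Module.finrank ℤ (X.redHomology i) = 0)
    (I : Finset (X.Face (i + 1))) (hI : I.card = X.coboundaryRank i)
    (hdet : ((coboundaryBasisMatrix D).submatrix id (I.orderEmbOfFin hI)).det ≠ 0) :
    X.weight i I = ((coboundaryBasisMatrix D).submatrix id (I.orderEmbOfFin hI)).det.natAbs := by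
  rw [← card_quotient_span_col _ hdet, ← Submodule.card_quotient_submoduleOf_map
    (coboundaryCoordMatrix D).mulVecLin (mulVec_coboundaryCoordMatrix_injective D)
    (range_coboundaryCoordMatrix D hX)]
  have : X.subBoundaries i I = (Submodule.span ℤ (Set.range
      ((coboundaryBasisMatrix D).submatrix id (I.orderEmbOfFin hI)).col)).map
      (coboundaryCoordMatrix D).mulVecLin := by
    rw [subBoundaries, Submodule.map_span, Submodule.map_span, ← Finset.range_orderEmbOfFin I hI,
      ← Set.range_comp, ← Set.range_comp, ← Set.range_comp]
    congr 2
    funext j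
    simp only [Function.comp_apply, bdMap, mulVecLin_apply, ← coboundaryCoordMatrix_mul D,
      mulVec_single_one]
    rfl
  rw [weight, subRedHomology, this]

theorem isSpanningTree_iff (I : Finset (X.Face (i + 1))) :
    X.IsSpanningTree i I ↔ ∃ h : I.card = X.coboundaryRank i,
      ((coboundaryBasisMatrix D).submatrix id (I.orderEmbOfFin h)).det ≠ 0 := by
  obtain ⟨R, hR⟩ := exists_mul_coboundaryCoordMatrix_eq_one D
  set Q := coboundaryCoordMatrix D
  set A := coboundaryBasisMatrix D
  let f := Int.castRingHom ℚ
  let Aq : Matrix _ _ ℚ := A.map f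
  let g : (Fin (X.coboundaryRank i) → ℚ) →ₗ[ℚ] (X.Face i → ℚ) := (Q.map f).mulVecLin
  have hdet : ∀ (I : Finset (X.Face (i + 1))) (h : I.card = X.coboundaryRank i),
      (Aq.submatrix id (I.orderEmbOfFin h)).det ≠ 0 ↔
        (A.submatrix id (I.orderEmbOfFin h)).det ≠ 0 := by
    intro I h
    have : Aq.submatrix id (I.orderEmbOfFin h) = f.mapMatrix (A.submatrix id (I.orderEmbOfFin h)) :=
      rfl
    rw [this, ← RingHom.map_det]
    simp [f]
  have hg : Function.Injective g := by
    have hRq : R.map f * Q.map f = 1 := by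
      rw [← Matrix.map_mul, hR]
      simp
    intro x y h
    have := congrArg (R.map f *ᵥ ·) h
    simpa [g, mulVec_mulVec, hRq] using this
  have hcol : X.bdCol i = g ∘ Aq.col := by
    funext e r
    have := congrArg f (congrFun (congrFun (coboundaryCoordMatrix_mul D) r) e)
    rw [mul_apply, map_sum] at this
    simp only [map_mul] at this
    exact this.symm
  -- The Gram determinant is nonzero, so by Cauchy–Binet some maximal minor is too.
  have htop : Submodule.span ℚ (Set.range Aq.col) = ⊤ := by
    have h1 := det_mul_transpose_ne_zero (linearIndependent_coboundaryBasisMatrix D)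
    rw [cauchyBinet] at h1
    obtain ⟨U, -, hU⟩ := Finset.exists_ne_zero_of_sum_ne_zero h1
    have h2 := ((linearIndepOn_col_and_span_eq_top_iff Aq U.1).mpr
      ⟨U.2, (hdet U.1 U.2).mpr (left_ne_zero_of_mul hU)⟩).2
    rw [eq_top_iff, ← h2]
    exact Submodule.span_mono (Set.image_subset_range _ _)
  rw [IsSpanningTree, hcol, Set.image_comp, Set.range_comp, ← Submodule.map_span,
    ← Submodule.map_span, (Submodule.map_injective_of_injective hg).eq_iff, htop,
    LinearMap.linearIndepOn_iff_of_injOn g hg.injOn, linearIndepOn_col_and_span_eq_top_iff]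
  exact exists_congr fun h => hdet I h

/-- In the Cauchy–Binet expansion the nonzero minors are exactly those of trees, and their squares
are the squared weights. -/
theorem treeNumber_eq (hX : Module.finrank ℤ (X.redHomology i) = 0) :
    (X.treeNumber i : ℤ) = (coboundaryBasisMatrix D * (coboundaryBasisMatrix D)ᵀ).det := by
  classical
  rw [cauchyBinet, treeNumber]
  have h1 : ∀ U : {I : Finset (X.Face (i + 1)) // I.card = X.coboundaryRank i},
      ((coboundaryBasisMatrix D).submatrix id (U.1.orderEmbOfFin U.2)).det *
        ((coboundaryBasisMatrix D).submatrix id (U.1.orderEmbOfFin U.2)).det =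
      if X.IsSpanningTree i U.1 then (X.weight i U.1 : ℤ) ^ 2 else 0 := by
    intro U
    by_cases h : ((coboundaryBasisMatrix D).submatrix id (U.1.orderEmbOfFin U.2)).det = 0
    · rw [if_neg, h, mul_zero]
      rintro hT
      obtain ⟨_, h'⟩ := (isSpanningTree_iff D U.1).mp hT
      exact h' h
    · rw [if_pos ((isSpanningTree_iff D U.1).mpr ⟨U.2, h⟩), weight_eq_natAbs_det D hX U.1 U.2 h,
        Int.natCast_natAbs, sq_abs, sq]
  rw [Finset.sum_congr rfl fun U _ => h1 U, Finset.sum_filter]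
  rw [← Finset.sum_subtype (Finset.univ.filter
    fun I : Finset (X.Face (i + 1)) => I.card = X.coboundaryRank i) (by simp)
    (fun I => if X.IsSpanningTree i I then (X.weight i I : ℤ) ^ 2 else 0)]
  push_cast
  symm
  refine Finset.sum_subset (Finset.subset_univ _) fun I _ hI => if_neg fun hT => hI ?_
  obtain ⟨h, -⟩ := (isSpanningTree_iff D I).mp hT
  simpa using h

end TreeNumber

end CellComplex

/-! ### The cutting form and the standard harmonic cocycle. -/

namespace CellComplex

variable {X : CellComplex.{u}}

section Harmonic

variable {i : ℕ} (Z : Module.Basis (Fin (X.cocycleRank i)) ℤ (X.cocycles (i + 2)))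
  (W : Module.Basis (Fin (X.coboundaryRank i + 1)) ℤ (X.cocycles (i + 1)))
  (D : Module.Basis (Fin (X.coboundaryRank i)) ℤ (X.coboundaries (i + 1)))

/-- The basis vectors of `B^i`, as elements of `Z^i`. -/
noncomputable def coboundaryBasisVec (j : Fin (X.coboundaryRank i)) : X.cocycles (i + 1) :=
  ⟨D j, X.coboundaries_le_cocycles (i + 1) (D j).2⟩

theorem cuttingNumber_eq_det (z : X.cocycles (i + 1)) :
    cuttingNumber W D z = W.det (Fin.cons z (coboundaryBasisVec D)) := rfl

/-- The cutting number as a linear form on `Z^i`. -/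
noncomputable def cuttingForm : X.cocycles (i + 1) →ₗ[ℤ] ℤ :=
  W.det.toMultilinearMap.toLinearMap (Fin.cons 0 (coboundaryBasisVec D)) 0

theorem cuttingForm_apply (z : X.cocycles (i + 1)) :
    cuttingForm W D z = cuttingNumber W D z := by
  rw [cuttingNumber_eq_det, cuttingForm, MultilinearMap.toLinearMap_apply, Fin.update_cons_zero]
  rfl

theorem cuttingForm_coboundaryBasisVec (j : Fin (X.coboundaryRank i)) :
    cuttingForm W D (coboundaryBasisVec D j) = 0 := by
  rw [cuttingForm_apply, cuttingNumber_eq_det]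
  exact W.det.map_eq_zero_of_eq _ (i := 0) (j := j.succ) (by simp) (Fin.succ_ne_zero j).symm

/-- `B^i` has rank one less than `Z^i`, so some `z` is independent of it; the nonzero Gram
determinant of the enlarged family has `c(z)` as a factor. -/
theorem exists_cuttingForm_ne_zero : ∃ z, cuttingForm W D z ≠ 0 := by
  have hD : LinearIndependent ℤ (coboundaryBasisVec D) :=
    LinearIndependent.of_comp (Submodule.subtype _) (linearIndependent_coboundaryBasisMatrix D)
  obtain ⟨z, hz⟩ := exists_linearIndependent_cons_of_lt_finrank hD
    (by rw [Module.finrank_eq_card_basis W]; simp)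
  refine ⟨z, fun h => ?_⟩
  have h1 := det_mul_transpose_ne_zero (hz.map' (Submodule.subtype _) (Submodule.ker_subtype _))
  apply h1
  refine (det_gram_eq W _ _).trans ?_
  rw [cuttingForm_apply, cuttingNumber_eq_det, Module.Basis.det_apply] at h
  rw [h, zero_mul, zero_mul]

theorem cobdMatrix_mulVec_cocycle (z : X.cocycles (i + 1)) :
    cobdMatrix Z *ᵥ (z : X.Face (i + 1) → ℤ) = 0 := by
  ext k
  have : (⟨X.cobdMap (i + 1) z, X.cobdMap_mem_cocycles (i + 1) _⟩ : X.cocycles (i + 2)) = 0 :=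
    Subtype.ext z.2
  rw [cobdMatrix_mulVec, this]
  simp

/-- By the bordered Cauchy–Binet identity the difference of the two sides is orthogonal to all of
`Z^i`; it lies in `Z^i` itself, hence is zero. -/
theorem sum_dotProduct_smul_cocyclePart (z : X.cocycles (i + 1)) :
    ∑ U : X.DualCycletree i, ((z : X.Face (i + 1) → ℤ) ⬝ᵥ cocyclePartVec Z U) • cocyclePart Z U =
      dualTreeNumber Z • z := by
  rw [← sub_eq_zero]
  set d := ∑ U : X.DualCycletree i,
    ((z : X.Face (i + 1) → ℤ) ⬝ᵥ cocyclePartVec Z U) • cocyclePart Z U - dualTreeNumber Z • z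
    with hd
  have key : ∀ y : X.cocycles (i + 1), (y : X.Face (i + 1) → ℤ) ⬝ᵥ (d : X.Face (i + 1) → ℤ) = 0 := by
    intro y
    have h := sum_dotProduct_extOrthVector_mul (cobdMatrix Z) y z (cobdMatrix_mulVec_cocycle Z y)
    have hc : (d : X.Face (i + 1) → ℤ) = ∑ U : X.DualCycletree i,
        ((z : X.Face (i + 1) → ℤ) ⬝ᵥ cocyclePartVec Z U) • cocyclePartVec Z U -
          dualTreeNumber Z • (z : X.Face (i + 1) → ℤ) := by
      simp only [hd, Submodule.coe_sub, Submodule.coe_sum, Submodule.coe_smul]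
      rfl
    rw [hc, dotProduct_sub, dotProduct_sum, sub_eq_zero, dotProduct_smul]
    simp only [dotProduct_smul, smul_eq_mul]
    rw [dotProduct_comm (y : X.Face (i + 1) → ℤ) (z : X.Face (i + 1) → ℤ)]
    exact h
  exact Subtype.ext (dotProduct_self_eq_zero.mp (key d))

theorem dotProduct_harmonicCocycle (z : X.cocycles (i + 1)) :
    (z : X.Face (i + 1) → ℤ) ⬝ᵥ (harmonicCocycle Z W D : X.Face (i + 1) → ℤ) =
      dualTreeNumber Z * cuttingForm W D z := by
  have h := congrArg (cuttingForm W D) (sum_dotProduct_smul_cocyclePart Z z)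
  rw [map_smul, smul_eq_mul] at h
  rw [← h, map_sum, harmonicCocycle, Submodule.coe_sum, dotProduct_sum]
  refine Finset.sum_congr rfl fun U _ => ?_
  rw [map_smul, Submodule.coe_smul, dotProduct_smul, cuttingForm_apply, smul_eq_mul, smul_eq_mul,
    mul_comm]
  rfl

/-- For `x` with `c(x) ≠ 0`, the mixed Gram determinant of `(x, D)` and `(λ*, D)` is `c(x) c(λ*)
G(W)` by change of basis, and `G(D) (x · λ*) = G(D) k^i c(x)` because `λ*` is orthogonal to `D`.
Then `c(x)` cancels. -/
theorem cuttingForm_harmonicCocycle_mul :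
    cuttingForm W D (harmonicCocycle Z W D) *
        (of (fun k => (W k : X.Face (i + 1) → ℤ)) *
          (of (fun k => (W k : X.Face (i + 1) → ℤ)))ᵀ).det =
      dualTreeNumber Z * (coboundaryBasisMatrix D * (coboundaryBasisMatrix D)ᵀ).det := by
  obtain ⟨x, hx⟩ := exists_cuttingForm_ne_zero W D
  have hcons : ∀ z : X.cocycles (i + 1),
      of (fun k => ((Fin.cons z (coboundaryBasisVec D) : Fin (X.coboundaryRank i + 1) →
        X.cocycles (i + 1)) k : X.Face (i + 1) → ℤ)) =
      border (z : X.Face (i + 1) → ℤ) (coboundaryBasisMatrix D) := by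
    intro z
    ext k e
    cases k using Fin.cases <;> rfl
  have hD : coboundaryBasisMatrix D *ᵥ (harmonicCocycle Z W D : X.Face (i + 1) → ℤ) = 0 := by
    ext j
    have := dotProduct_harmonicCocycle Z W D (coboundaryBasisVec D j)
    rw [cuttingForm_coboundaryBasisVec, mul_zero] at this
    exact this
  have h := det_gram_eq W (Fin.cons x (coboundaryBasisVec D))
    (Fin.cons (harmonicCocycle Z W D) (coboundaryBasisVec D))
  rw [hcons, hcons, det_border_mul_border_transpose _ _ _ hD, dotProduct_harmonicCocycle,
    ← Module.Basis.det_apply, ← Module.Basis.det_apply, ← cuttingNumber_eq_det,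
    ← cuttingNumber_eq_det, ← cuttingForm_apply, ← cuttingForm_apply] at h
  apply mul_left_cancel₀ hx
  rw [← mul_assoc, ← h]
  ring

end Harmonic

end CellComplex

theorem mainTheorem8 (X : CellComplex.{u}) (i : ℕ) (hX : X.Unicycle i)
    (Z Z' : Module.Basis (Fin (X.cocycleRank i)) ℤ (X.cocycles (i + 2)))
    (W : Module.Basis (Fin (X.coboundaryRank i + 1)) ℤ (X.cocycles (i + 1)))
    (D : Module.Basis (Fin (X.coboundaryRank i)) ℤ (X.coboundaries (i + 1))) :
    Finite (X.redCohomology (i + 2)) ∧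
      (CellComplex.harmonicCocycle Z W D : X.Face (i + 1) → ℤ) ⬝ᵥ
          (CellComplex.harmonicCocycle Z W D : X.Face (i + 1) → ℤ) =
        CellComplex.dualTreeNumber Z' * (X.treeNumber i : ℤ) *
          (Nat.card (X.redCohomology (i + 2)) : ℤ) ^ 2 := by
  refine ⟨CellComplex.finite_redCohomology hX.rank_succ, ?_⟩
  have hZ := CellComplex.dualTreeNumber_eq hX.rank_succ Z W
  have hZ' := CellComplex.dualTreeNumber_eq hX.rank_succ Z' W
  have hc := CellComplex.cuttingForm_harmonicCocycle_mul Z W D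
  have hG := det_mul_transpose_ne_zero
    (W.linearIndependent.map' (Submodule.subtype _) (Submodule.ker_subtype _))
  change (of (fun k => (W k : X.Face (i + 1) → ℤ)) *
    (of (fun k => (W k : X.Face (i + 1) → ℤ)))ᵀ).det ≠ 0 at hG
  -- `Z` and `Z'` give the same dual tree number, both being equal to `h² G(W)`.
  rw [CellComplex.dotProduct_harmonicCocycle, CellComplex.treeNumber_eq D hX.rank_pred, hZ',
    ← hZ, mul_assoc]
  congr 1
  apply mul_right_cancel₀ hG
  rw [hc, hZ]
  ring
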